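/- Let $A:[1,\infty)\to(0,\infty)$ be a non-decreasing $C^1$-function such that $\int_1^\infty \frac{ds}{A(s)}=+\infty$ and $\gamma:=\sup_{s\ge 1}\frac{sA'(s)}{A(s)}<\infty$. Put $M_0=1$ and $M_j=M_{j-1}A(j)$ for $j\ge 1$, and let $\mathcal C_A([0,1])$ (a regular quasianalytic Denjoy–Carleman class) be the set of real-valued functions $f\in C^\infty([0,1])$ with $\sup_{[0,1]}|f^{(j)}|\le M_j$ for all $j\ge 0$. For a set $E$ write $\|f\|_E=\sup_E|f|$. Set $$\Omega(t)=\exp\Big[-\frac1e\int_1^{\log(e/t)}\frac{ds}{A(s)}\Big]\quad(0<t\le 1),\qquad \Omega(0)=0,$$ and, for a Lebesgue measurable set $E\subset[0,1]$ of positive Lebesgue measure $|E|$, $$\alpha(E)=\frac{1}{3\log(\Gamma/|E|)},\qquad \Gamma=4e^{4+\frac2e\gamma}.$$ Then for every $f\in\mathcal C_A([0,1])$ and every Lebesgue measurable $E\subset[0,1]$ with $|E|>0$, $$\Omega\big(\|f\|_{[0,1]}\big)\le e\,\Omega\big(\|f\|_E^{\alpha(E)}\big).$$ -/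

import Mathlib

open scoped ContDiff

noncomputable section

namespace DenjoyCarleman

/-- The logarithmic growth exponent `γ = sup_{s ≥ 1} s A'(s) / A(s)`
(`A` lives on `[1, ∞)`; the derivative at `1` is one-sided). -/
def growthExponent (A : ℝ → ℝ) : ℝ :=
  sSup ((fun s => s * derivWithin A (Set.Ici 1) s / A s) '' Set.Ici 1)

/-- `A : [1, ∞) → (0, ∞)` defines a regular quasianalytic class: it is a non-decreasing
`C¹`-function, the integral of `1 / A` diverges at infinity, and `γ` is finite. -/
structure IsRegularQuasianalytic (A : ℝ → ℝ) : Prop where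
  pos : ∀ s, 1 ≤ s → 0 < A s
  monotoneOn : MonotoneOn A (Set.Ici 1)
  contDiffOn : ContDiffOn ℝ 1 A (Set.Ici 1)
  diverges : Filter.Tendsto (fun T : ℝ => ∫ s in (1 : ℝ)..T, (A s)⁻¹) Filter.atTop Filter.atTop
  bddAbove : BddAbove ((fun s => s * derivWithin A (Set.Ici 1) s / A s) '' Set.Ici 1)

/-- The normalized sequence `M 0 = 1`, `M j = M (j - 1) * A j`. -/
def M (A : ℝ → ℝ) : ℕ → ℝ
  | 0 => 1
  | j + 1 => M A j * A ((j : ℝ) + 1)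

/-- The normalized Denjoy–Carleman class on `[0, 1]`: functions that are `C^∞` on `[0, 1]` with
`|f⁽ʲ⁾| ≤ M j` there, for all `j ≥ 0` (derivatives are one-sided at the end-points; the values
of `f` outside `[0, 1]` play no role). -/
def carlemanClass (A : ℝ → ℝ) : Set (ℝ → ℝ) :=
  {f | ContDiffOn ℝ ∞ f (Set.Icc 0 1) ∧
    ∀ (j : ℕ), ∀ x ∈ Set.Icc (0 : ℝ) 1, |iteratedDerivWithin j f (Set.Icc 0 1) x| ≤ M A j}

/-- The uniform norm of `f` on the set `E`. -/
def supNorm (f : ℝ → ℝ) (E : Set ℝ) : ℝ :=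
  sSup ((fun x => |f x|) '' E)

/-- `Ω t = exp (-(1/e) ∫_1^{log (e/t)} ds / A s)` for `0 < t ≤ 1`, and `Ω 0 = 0`: at `t = 0` the
upper limit of integration is `+∞` and the integral of `1 / A` diverges to `+∞`. -/
def Omega (A : ℝ → ℝ) (t : ℝ) : ℝ :=
  if t = 0 then 0
  else Real.exp (-(1 / Real.exp 1) * ∫ s in (1 : ℝ)..Real.log (Real.exp 1 / t), (A s)⁻¹)

/-- The constant `Γ = 4 e^{4 + (2/e) γ}`. -/
def Gam (A : ℝ → ℝ) : ℝ :=
  4 * Real.exp (4 + 2 / Real.exp 1 * growthExponent A)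

/-- `α(E) = (1/3) / log (Γ / |E|)`, with `|E|` the Lebesgue measure of `E`. -/
def alpha (A : ℝ → ℝ) (E : Set ℝ) : ℝ :=
  1 / 3 * (Real.log (Gam A / (MeasureTheory.volume E).toReal))⁻¹

end DenjoyCarleman

end

open Set Polynomial

/-! Write Ψ for `invPrimitive A`, let |f(a)| = e^{-L} be the maximum of |f|, and suppose |f| ≤
exp(-3ΛT) on a set of measure δ, where Λ = log(Γ/δ). The heart of the matter is Ψ(1+T) ≤ Ψ(1+L) + e;
dividing by e and exponentiating turns the loss e into the factor e.

After a possible reflection, half of the set lies to the right of a and contains about T nodes with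
gaps of order δ/T. The Lagrange interpolant P of f at these nodes has tiny derivatives, and
iterating Rolle gives points ξ_0 ≤ ξ_1 ≤ ... with f^(j)(ξ_j) = P^(j)(ξ_j). Hence |f^(j)(ξ_j)| ≤ M_j
e^{j-T}; this comparison needs M_j ≥ e^{-L} j!/2, which the interpolation error at a forces
(`invPrimitive_le_of_small_right`).

By Bang's argument (`smallFrom_of_le`), the bounds |f^(i)| ≤ M_i e^{i-τ}, i ≥ j, survive a move to
the left by d if Ψ(1+τ) is lowered by e·d. Starting at the last ξ_j, where the high orders are
trivially bounded, and gaining one order at each ξ_j, one reaches a with total loss at most e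
(`smallFrom_chain`). If Ψ(1+T) > Ψ(1+L) + e, this gives |f(a)| ≤ e^{-τ} with τ > L, a contradiction.
-/

/-! ### Rolle chains and Lagrange interpolation at separated nodes -/

/-- Rolle puts the first zero of the next derivative to the right of the current first zero, so
following first zeros gives a monotone chain. -/
theorem exists_zero_chain : ∀ (n : ℕ) (G : ℕ → ℝ → ℝ) (x : ℕ → ℝ),
    (∀ j, ∀ t ∈ Icc (0 : ℝ) 1, HasDerivWithinAt (G j) (G (j + 1) t) (Icc 0 1) t) →
    (∀ i < n + 1, x i ∈ Icc (0 : ℝ) 1) → (∀ i < n, x i < x (i + 1)) →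
    (∀ i < n + 1, G 0 (x i) = 0) →
    ∃ ξ : ℕ → ℝ, ξ 0 = x 0 ∧ (∀ j < n, ξ j ≤ ξ (j + 1)) ∧
      ∀ j < n + 1, ξ j ∈ Icc (0 : ℝ) 1 ∧ G j (ξ j) = 0 := by
  intro n
  induction n with
  | zero =>
    intro G x _ hx _ h0
    refine ⟨fun _ => x 0, rfl, by simp, fun j hj => ?_⟩
    obtain rfl : j = 0 := by omega
    exact ⟨hx 0 hj, h0 0 hj⟩
  | succ n ih =>
    intro G x hG hx hlt h0
    have key : ∀ i, ∃ y, i < n + 1 → y ∈ Ioo (x i) (x (i + 1)) ∧ G 1 y = 0 := by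
      intro i
      by_cases hi : i < n + 1
      · have hsub : Icc (x i) (x (i + 1)) ⊆ Icc 0 1 :=
          Icc_subset_Icc (hx i (by omega)).1 (hx (i + 1) (by omega)).2
        obtain ⟨c, hc, hc0⟩ := exists_hasDerivAt_eq_zero (f := G 0) (f' := G 1) (hlt i hi)
          (fun t ht => ((hG 0 t (hsub ht)).continuousWithinAt).mono hsub)
          (by rw [h0 i (by omega), h0 (i + 1) (by omega)])
          (fun t ht => (hG 0 t (hsub (Ioo_subset_Icc_self ht))).hasDerivAt
            (Filter.mem_of_superset (Icc_mem_nhds ht.1 ht.2) hsub))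
        exact ⟨c, fun _ => ⟨hc, hc0⟩⟩
      · exact ⟨0, fun h => absurd h hi⟩
    choose y hy using key
    obtain ⟨ξ, hξ0, hξm, hξ⟩ := ih (fun j => G (j + 1)) y (fun j => hG (j + 1))
      (fun i hi => ⟨(hx i (by omega)).1.trans (hy i hi).1.1.le,
        (hy i hi).1.2.le.trans (hx (i + 1) (by omega)).2⟩)
      (fun i hi => (hy i (by omega)).1.2.trans (hy (i + 1) (by omega)).1.1)
      (fun i hi => (hy i hi).2)
    refine ⟨fun j => Nat.casesOn j (x 0) ξ, rfl, ?_, ?_⟩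
    · rintro (_ | j) hj
      · change x 0 ≤ ξ 0
        rw [hξ0]
        exact (hy 0 (by omega)).1.1.le
      · exact hξm j (by omega)
    · rintro (_ | j) hj
      · exact ⟨hx 0 hj, h0 0 hj⟩
      · exact hξ j (by omega)

theorem pow_mul_factorial_le_prod_abs_sub {n : ℕ} {x : ℕ → ℝ} {h : ℝ} (hh : 0 ≤ h)
    (hx : ∀ i j, i ≤ j → j < n + 1 → ((j : ℝ) - i) * h ≤ x j - x i) {i : ℕ} (hi : i < n + 1) :
    h ^ n * (i.factorial * (n - i).factorial) ≤
      ∏ j ∈ (Finset.range (n + 1)).erase i, |x i - x j| := by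
  have hsplit : (Finset.range (n + 1)).erase i =
      (Finset.range i) ∪ (Finset.range (n - i)).image (fun k => i + 1 + k) := by
    ext k
    simp only [Finset.mem_erase, Finset.mem_range, Finset.mem_union, Finset.mem_image]
    constructor
    · rintro ⟨h1, h2⟩
      rcases lt_or_gt_of_ne h1 with h3 | h3
      · exact Or.inl h3
      · exact Or.inr ⟨k - (i + 1), by omega, by omega⟩
    · rintro (h1 | ⟨a, h1, rfl⟩) <;> omega
  rw [hsplit, Finset.prod_union, Finset.prod_image (by intro a _ b _ hab; simpa using hab)]
  · have h1 : h ^ i * i.factorial ≤ ∏ j ∈ Finset.range i, |x i - x j| := by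
      have : (h ^ i * i.factorial : ℝ) = ∏ j ∈ Finset.range i, ((i : ℝ) - j) * h := by
        rw [Finset.prod_mul_distrib, Finset.prod_const, Finset.card_range, mul_comm]
        congr 1
        rw [← Finset.prod_range_add_one_eq_factorial, ← Finset.prod_range_reflect]
        push_cast
        refine Finset.prod_congr rfl fun j hj => ?_
        rw [Finset.mem_range] at hj
        rw [Nat.sub_sub, Nat.cast_sub (by omega)]
        push_cast
        ring
      rw [this]
      refine Finset.prod_le_prod (fun j hj => ?_) (fun j hj => ?_)
      · rw [Finset.mem_range] at hj
        have : (j : ℝ) ≤ i := by exact_mod_cast hj.le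
        exact mul_nonneg (by linarith) hh
      · rw [Finset.mem_range] at hj
        exact (hx j i hj.le hi).trans (le_abs_self _)
    have h2 : h ^ (n - i) * (n - i).factorial ≤
        ∏ k ∈ Finset.range (n - i), |x i - x (i + 1 + k)| := by
      have : (h ^ (n - i) * (n - i).factorial : ℝ) =
          ∏ k ∈ Finset.range (n - i), ((k : ℝ) + 1) * h := by
        rw [Finset.prod_mul_distrib, Finset.prod_const, Finset.card_range, mul_comm]
        congr 1
        rw [← Finset.prod_range_add_one_eq_factorial]
        push_cast
        rfl
      rw [this]
      refine Finset.prod_le_prod (fun j hj => by positivity) (fun k hk => ?_)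
      rw [Finset.mem_range] at hk
      have := hx i (i + 1 + k) (by omega) (by omega)
      rw [abs_sub_comm]
      refine le_trans ?_ (this.trans (le_abs_self _))
      push_cast
      apply le_of_eq
      ring
    have h3 : h ^ n = h ^ i * h ^ (n - i) := by rw [← pow_add]; congr 1; omega
    calc h ^ n * (i.factorial * (n - i).factorial)
        = (h ^ i * i.factorial) * (h ^ (n - i) * (n - i).factorial) := by rw [h3]; ring
      _ ≤ _ := mul_le_mul h1 h2 (by positivity) (by positivity)
  · rw [Finset.disjoint_left]
    intro a ha hb
    simp only [Finset.mem_range, Finset.mem_image] at ha hb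
    obtain ⟨k, _, rfl⟩ := hb
    omega

theorem sum_inv_factorial_mul_factorial (n : ℕ) :
    ∑ i ∈ Finset.range (n + 1), ((i.factorial : ℝ) * (n - i).factorial)⁻¹ =
      2 ^ n / n.factorial := by
  have h := Nat.sum_range_choose n
  have h' : ∑ i ∈ Finset.range (n + 1), (n.choose i : ℝ) = 2 ^ n := by exact_mod_cast h
  rw [← h', Finset.sum_div]
  refine Finset.sum_congr rfl fun i hi => ?_
  rw [Finset.mem_range] at hi
  rw [Nat.cast_choose ℝ (by omega : i ≤ n)]
  have : (n.factorial : ℝ) ≠ 0 := by positivity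
  field_simp

/-- In the explicit formula for the derivative, each inner sum has at most 2^n products, all bounded
by 1; the denominators are at least h^n i!(n-i)!, and their reciprocals sum to a second factor 2^n.
-/
theorem abs_eval_iterate_derivative_interpolate_le {n : ℕ} {x r : ℕ → ℝ} {h s : ℝ} (hh : 0 < h)
    (hs : 0 ≤ s) (hx : ∀ i j, i ≤ j → j < n + 1 → ((j : ℝ) - i) * h ≤ x j - x i)
    (hx01 : ∀ i < n + 1, x i ∈ Icc (0 : ℝ) 1) (hr : ∀ i < n + 1, |r i| ≤ s) {k : ℕ}
    (hk : k < n + 1) {y : ℝ} (hy : y ∈ Icc (0 : ℝ) 1) :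
    |(derivative^[k] (Lagrange.interpolate (Finset.range (n + 1)) x r)).eval y| ≤
      s * k.factorial * (4 / h) ^ n / n.factorial := by
  have hlt : ∀ i j, i < j → j < n + 1 → x i < x j := by
    intro i j hij hj
    have h1 := hx i j hij.le hj
    have h2 : (i : ℝ) < j := by exact_mod_cast hij
    nlinarith [mul_pos (sub_pos.2 h2) hh]
  have hinj : Set.InjOn x (Finset.range (n + 1) : Finset ℕ) := by
    intro i hi j hj hij
    simp only [Finset.coe_range, mem_Iio] at hi hj
    rcases lt_trichotomy i j with h1 | h1 | h1
    · exact absurd hij (hlt i j h1 hj).ne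
    · exact h1
    · exact absurd hij (hlt j i h1 hi).ne'
  rw [Lagrange.iterate_derivative_interpolate _ hinj (by simpa using hk)]
  simp only [eval_mul, eval_natCast, eval_finsetSum, eval_C, eval_prod, eval_sub, eval_X,
    Finset.card_range]
  rw [abs_mul, Nat.abs_cast]
  have hterm : ∀ i ∈ Finset.range (n + 1),
      |(r i / ∏ j ∈ (Finset.range (n + 1)).erase i, (x i - x j)) *
        ∑ t ∈ ((Finset.range (n + 1)).erase i).powersetCard (n + 1 - (k + 1)),
          ∏ a ∈ t, (y - x a)| ≤
      (s * (2 / h) ^ n) * ((i.factorial : ℝ) * (n - i).factorial)⁻¹ := by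
    intro i hi
    have hi' := Finset.mem_range.1 hi
    have h1 : |∑ t ∈ ((Finset.range (n + 1)).erase i).powersetCard (n + 1 - (k + 1)),
          ∏ a ∈ t, (y - x a)| ≤ 2 ^ n := by
      calc _ ≤ ∑ t ∈ ((Finset.range (n + 1)).erase i).powersetCard (n + 1 - (k + 1)),
            |∏ a ∈ t, (y - x a)| := Finset.abs_sum_le_sum_abs _ _
        _ ≤ ∑ t ∈ ((Finset.range (n + 1)).erase i).powersetCard (n + 1 - (k + 1)), (1 : ℝ) := by
            refine Finset.sum_le_sum fun t ht => ?_
            rw [Finset.abs_prod]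
            refine Finset.prod_le_one (fun _ _ => abs_nonneg _) fun a ha => ?_
            have ha' := Finset.mem_range.1
              (Finset.mem_of_mem_erase ((Finset.mem_powersetCard.1 ht).1 ha))
            have := hx01 a ha'
            rw [abs_le]
            constructor <;> linarith [this.1, this.2, hy.1, hy.2]
        _ ≤ 2 ^ n := by
            rw [Finset.sum_const, Finset.card_powersetCard, Finset.card_erase_of_mem hi,
              Finset.card_range, nsmul_eq_mul, mul_one]
            exact_mod_cast Nat.choose_le_two_pow _ _
    have h2 := pow_mul_factorial_le_prod_abs_sub hh.le hx hi'
    rw [abs_mul, abs_div, Finset.abs_prod]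
    have hpos : 0 < h ^ n * ((i.factorial : ℝ) * (n - i).factorial) := by positivity
    calc _ ≤ s / (h ^ n * ((i.factorial : ℝ) * (n - i).factorial)) * 2 ^ n := by
          gcongr
          exact hr i hi'
      _ = _ := by
          rw [div_pow]
          field_simp
  calc _ ≤ (k.factorial : ℝ) * ∑ i ∈ Finset.range (n + 1),
        (s * (2 / h) ^ n) * ((i.factorial : ℝ) * (n - i).factorial)⁻¹ := by
        gcongr
        exact (Finset.abs_sum_le_sum_abs _ _).trans (Finset.sum_le_sum hterm)
    _ = _ := by
        rw [← Finset.mul_sum, sum_inv_factorial_mul_factorial]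
        rw [show (4 / h : ℝ) = 2 / h * 2 by ring, mul_pow]
        ring

/-- Greedy choice: take the least point of K and discard an interval of length h starting there,
which costs measure at most h. -/
theorem exists_separated_nodes {h : ℝ} (hh : 0 ≤ h) : ∀ (n : ℕ) (K : Set ℝ), IsCompact K →
    ENNReal.ofReal (n * h) < MeasureTheory.volume K →
    ∃ x : ℕ → ℝ, (∀ i < n + 1, x i ∈ K) ∧ ∀ i < n, x i + h ≤ x (i + 1) := by
  intro n
  induction n with
  | zero =>
    intro K _ hv
    have hne : K.Nonempty := by
      rw [nonempty_iff_ne_empty]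
      rintro rfl
      simp at hv
    obtain ⟨a, ha⟩ := hne
    exact ⟨fun _ => a, fun _ _ => ha, by simp⟩
  | succ n ih =>
    intro K hK hv
    have hne : K.Nonempty := by
      rw [nonempty_iff_ne_empty]
      rintro rfl
      simp at hv
    obtain ⟨a, ha, hmin⟩ := hK.exists_isLeast hne
    have hcov : K ⊆ Icc a (a + h) ∪ (K ∩ Ici (a + h)) := by
      intro t ht
      rcases le_total t (a + h) with h1 | h1
      · exact Or.inl ⟨hmin ht, h1⟩
      · exact Or.inr ⟨ht, h1⟩
    have hvol : ENNReal.ofReal (n * h) < MeasureTheory.volume (K ∩ Ici (a + h)) := by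
      by_contra hcon
      rw [not_lt] at hcon
      refine absurd hv (not_lt.2 ?_)
      calc MeasureTheory.volume K ≤ _ := MeasureTheory.measure_mono hcov
        _ ≤ _ := MeasureTheory.measure_union_le _ _
        _ ≤ ENNReal.ofReal h + ENNReal.ofReal (n * h) := by
            gcongr
            rw [Real.volume_Icc]
            simp
        _ = ENNReal.ofReal ((n + 1 : ℕ) * h) := by
            rw [← ENNReal.ofReal_add hh (by positivity)]
            congr 1
            push_cast
            ring
    obtain ⟨x, hx, hxh⟩ := ih _ (hK.inter_right isClosed_Ici) hvol
    refine ⟨fun j => Nat.casesOn j a x, ?_, ?_⟩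
    · rintro (_ | j) hj
      · exact ha
      · exact (hx j (by omega)).1
    · rintro (_ | j) hj
      · exact (hx 0 (by omega)).2
      · exact hxh j (by omega)

theorem sub_mul_le_sub_of_separated {n : ℕ} {x : ℕ → ℝ} {h : ℝ}
    (hx : ∀ i < n, x i + h ≤ x (i + 1)) (i j : ℕ) (hij : i ≤ j) (hj : j < n + 1) :
    ((j : ℝ) - i) * h ≤ x j - x i := by
  induction j, hij using Nat.le_induction with
  | base => simp
  | succ j hij ih =>
    have h1 := ih (by omega)
    have h2 := hx j (by omega)
    push_cast
    linarith

theorem hasDerivWithinAt_iterate_derivative (P : ℝ[X]) (j : ℕ) (s : Set ℝ) (t : ℝ) :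
    HasDerivWithinAt (fun t => (derivative^[j] P).eval t) ((derivative^[j + 1] P).eval t) s t := by
  rw [Function.iterate_succ_apply']
  exact (derivative^[j] P).hasDerivWithinAt t s

theorem iterate_derivative_nodal_range (n : ℕ) (x : ℕ → ℝ) :
    derivative^[n] (Lagrange.nodal (Finset.range n) x) = C (n.factorial : ℝ) := by
  have hdeg : (Lagrange.nodal (Finset.range n) x).natDegree = n := by
    rw [Lagrange.natDegree_nodal, Finset.card_range]
  have h0 : (derivative^[n] (Lagrange.nodal (Finset.range n) x)).natDegree = 0 := by
    have := natDegree_iterate_derivative (Lagrange.nodal (Finset.range n) x) n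
    omega
  rw [eq_C_of_natDegree_eq_zero h0, coeff_iterate_derivative, zero_add, Nat.descFactorial_self]
  have : (Lagrange.nodal (Finset.range n) x).coeff n = 1 := by
    have := (Lagrange.nodal_monic (s := Finset.range n) (v := x)).coeff_natDegree
    rwa [hdeg] at this
  rw [this]
  simp

/-- The classical remainder F_n(ξ)/n! times the nodal polynomial, whose value at a is at most 1 in
modulus since everything lies in [0, 1]. -/
theorem abs_sub_interpolate_le {F : ℕ → ℝ → ℝ} {n : ℕ} {x : ℕ → ℝ} {a B : ℝ}
    (hF : ∀ j, ∀ t ∈ Icc (0 : ℝ) 1, HasDerivWithinAt (F j) (F (j + 1) t) (Icc 0 1) t)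
    (hB : ∀ t ∈ Icc (0 : ℝ) 1, |F n t| ≤ B)
    (hx01 : ∀ i < n, x i ∈ Icc (0 : ℝ) 1) (ha : a ∈ Icc (0 : ℝ) 1)
    (hlt : ∀ i j, i < j → j < n → x i < x j) (hax : ∀ i < n, a ≤ x i) :
    |F 0 a - (Lagrange.interpolate (Finset.range n) x (fun i => F 0 (x i))).eval a| ≤
      B / n.factorial := by
  have hB0 : 0 ≤ B := (abs_nonneg _).trans (hB a ha)
  have hinj : Set.InjOn x (Finset.range n : Finset ℕ) := by
    intro i hi j hj hij
    simp only [Finset.coe_range, mem_Iio] at hi hj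
    rcases lt_trichotomy i j with h1 | h1 | h1
    · exact absurd hij (hlt i j h1 hj).ne
    · exact h1
    · exact absurd hij (hlt j i h1 hi).ne'
  set P := Lagrange.interpolate (Finset.range n) x (fun i => F 0 (x i)) with hP
  have hPx : ∀ i < n, P.eval (x i) = F 0 (x i) := fun i hi =>
    Lagrange.eval_interpolate_at_node _ hinj (Finset.mem_range.2 hi)
  by_cases heq : ∃ i < n, a = x i
  · obtain ⟨i, hi, rfl⟩ := heq
    rw [hPx i hi, sub_self, abs_zero]
    positivity
  · push Not at heq
    set W := Lagrange.nodal (Finset.range n) x with hW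
    have hW0 : W.eval a ≠ 0 := by
      rw [hW, Lagrange.eval_nodal, Finset.prod_ne_zero_iff]
      intro i hi
      exact sub_ne_zero.2 (heq i (Finset.mem_range.1 hi))
    have hW1 : |W.eval a| ≤ 1 := by
      rw [hW, Lagrange.eval_nodal, Finset.abs_prod]
      refine Finset.prod_le_one (fun _ _ => abs_nonneg _) fun i hi => ?_
      have := hx01 i (Finset.mem_range.1 hi)
      rw [abs_le]
      constructor <;> linarith [this.1, this.2, ha.1, ha.2]
    -- This c makes `F 0 - Q` vanish at a as well as at the n nodes, giving the n + 1 zeros needed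
    -- for an n-th derivative.
    set c := (F 0 a - P.eval a) / W.eval a with hc
    set Q := P + C c * W with hQ
    have hQn : derivative^[n] Q = C (c * n.factorial) := by
      rw [hQ, iterate_map_add derivative, iterate_derivative_C_mul, hW,
        iterate_derivative_nodal_range, iterate_derivative_eq_zero_of_degree_lt, zero_add, C_mul]
      have hdeg := Lagrange.degree_interpolate_lt (fun i => F 0 (x i)) hinj
      rwa [Finset.card_range] at hdeg
    obtain ⟨ξ, -, -, hξ⟩ := exists_zero_chain n
      (fun j t => F j t - (derivative^[j] Q).eval t)
      (fun j => Nat.casesOn j a x)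
      (fun j t ht => (hF j t ht).sub (hasDerivWithinAt_iterate_derivative Q j _ t))
      (by
        rintro (_ | j) hj
        · exact ha
        · exact hx01 j (by omega))
      (by
        rintro (_ | j) hj
        · exact lt_of_le_of_ne (hax 0 hj) (heq 0 hj)
        · exact hlt j (j + 1) (by omega) hj)
      (by
        rintro (_ | j) hj
        · change F 0 a - Q.eval a = 0
          rw [hQ, eval_add, eval_mul, eval_C, hc]
          field_simp
          ring
        · change F 0 (x j) - Q.eval (x j) = 0
          rw [hQ, eval_add, eval_mul, hPx j (by omega), hW,
            Lagrange.eval_nodal_at_node (Finset.mem_range.2 (by omega : j < n))]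
          ring)
    obtain ⟨h01, hz⟩ := hξ n (by omega)
    rw [hQn, eval_C, sub_eq_zero] at hz
    have h1 := hB _ h01
    rw [hz, abs_mul, Nat.abs_cast] at h1
    have h2 : |c| ≤ B / n.factorial := by rwa [le_div_iff₀ (by positivity)]
    have h3 : F 0 a - P.eval a = c * W.eval a := by rw [hc]; field_simp
    rw [h3, abs_mul]
    calc |c| * |W.eval a| ≤ |c| * 1 := by gcongr
      _ ≤ _ := by simpa using h2

/-! ### Bang's estimate with a constant ratio -/

/-- All derivatives of order at least `j` of the sequence `F` at `x` are small compared with `M`,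
with respect to the weights `exp (i - τ)`. -/
def SmallFrom (M : ℕ → ℝ) (F : ℕ → ℝ → ℝ) (j : ℕ) (x τ : ℝ) : Prop :=
  ∀ i, j ≤ i → |F i x| ≤ M i * Real.exp (i - τ)

theorem SmallFrom.mono {M : ℕ → ℝ} {F : ℕ → ℝ → ℝ} {j : ℕ} {x τ τ' : ℝ} (hM : ∀ i, 0 ≤ M i)
    (h : SmallFrom M F j x τ) (hτ : τ' ≤ τ) : SmallFrom M F j x τ' := fun i hi =>
  (h i hi).trans (mul_le_mul_of_nonneg_left (Real.exp_le_exp.2 (by linarith)) (hM i))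

theorem le_mul_exp_sub {m c τ : ℝ} {i : ℕ} (hm : 0 ≤ m) (hc : c ≤ m) (hi : τ ≤ i) :
    c ≤ m * Real.exp (i - τ) :=
  hc.trans (le_mul_of_one_le_right hm (Real.one_le_exp (by linarith)))

/-- Descending induction on the order: orders i ≥ k ≥ τ are trivially bounded, and below k the
majorant M_i exp(i - τ + e·a·u) grows at least as fast as the bound for the next derivative permits,
the factor e coming from the shift i → i + 1. -/
theorem SmallFrom.move_left {M : ℕ → ℝ} {F : ℕ → ℝ → ℝ} {j k : ℕ} {a x y τ : ℝ}
    (hF : ∀ j, ∀ t ∈ Icc (0 : ℝ) 1, HasDerivWithinAt (F j) (F (j + 1) t) (Icc 0 1) t)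
    (hFM : ∀ j, ∀ t ∈ Icc (0 : ℝ) 1, |F j t| ≤ M j) (ha : 0 ≤ a) (hM : ∀ i, 0 ≤ M i)
    (hMk : ∀ i < k, M (i + 1) ≤ a * M i) (hτ : τ ≤ k) (hx : x ≤ 1) (hy : 0 ≤ y) (hyx : y ≤ x)
    (h : SmallFrom M F j x τ) :
    SmallFrom M F j y (τ - Real.exp 1 * (a * (x - y))) := by
  have hc : 0 ≤ Real.exp 1 * a := by positivity
  have key : ∀ d i, j ≤ i → i + d = k → ∀ u ∈ Icc 0 x,
      |F i (x - u)| ≤ M i * Real.exp (i - (τ - Real.exp 1 * a * u)) := by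
    intro d
    induction d with
    | zero =>
      intro i _ hik u hu
      obtain rfl : i = k := hik
      refine le_mul_exp_sub (hM i) (hFM i _ ⟨by linarith [hu.2], by linarith [hu.1]⟩) ?_
      nlinarith [mul_nonneg hc hu.1]
    | succ d ih =>
      intro i hji hik u hu
      have hmaps : ∀ v ∈ Icc 0 x, x - v ∈ Icc (0 : ℝ) 1 := fun v hv =>
        ⟨by linarith [hv.2], by linarith [hv.1]⟩
      have hder : ∀ v ∈ Icc 0 x,
          HasDerivWithinAt (fun v => F i (x - v)) (-F (i + 1) (x - v)) (Icc 0 x) v := by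
        intro v hv
        have h1 : HasDerivWithinAt (fun v => x - v) (-1) (Icc 0 x) v :=
          ((hasDerivAt_id v).const_sub x).hasDerivWithinAt
        have := (hF i (x - v) (hmaps v hv)).comp v h1 hmaps
        simpa [Function.comp_def] using this
      have hBder : ∀ v, HasDerivAt (fun v => M i * Real.exp (i - (τ - Real.exp 1 * a * v)))
          (M i * (Real.exp (i - (τ - Real.exp 1 * a * v)) * (Real.exp 1 * a))) v := by
        intro v
        have h1 : HasDerivAt (fun v => (i : ℝ) - (τ - Real.exp 1 * a * v)) (Real.exp 1 * a) v := by
          have := (((hasDerivAt_id v).const_mul (Real.exp 1 * a)).const_sub τ).const_sub (i : ℝ)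
          simpa using this
        exact h1.exp.const_mul (M i)
      refine image_norm_le_of_norm_deriv_right_le_deriv_boundary' (a := 0) (b := x)
        (f := fun v => F i (x - v)) (f' := fun v => -F (i + 1) (x - v))
        (fun v hv => (hder v hv).continuousWithinAt) ?_ ?_
        (fun v _ => (hBder v).continuousAt.continuousWithinAt)
        (fun v _ => (hBder v).hasDerivWithinAt) ?_ hu
      · intro v hv
        exact (hder v ⟨hv.1, hv.2.le⟩).mono_of_mem_nhdsWithin
          (Filter.mem_of_superset (Icc_mem_nhdsGE hv.2) (Icc_subset_Icc hv.1 le_rfl))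
      · simpa using h i hji
      · intro v hv
        have h1 := ih (i + 1) (by omega) (by omega) v ⟨hv.1, hv.2.le⟩
        rw [Real.norm_eq_abs, abs_neg]
        refine h1.trans ?_
        have h2 := hMk i (by omega)
        have h3 : Real.exp (((i + 1 : ℕ) : ℝ) - (τ - Real.exp 1 * a * v)) =
            Real.exp 1 * Real.exp (i - (τ - Real.exp 1 * a * v)) := by
          rw [← Real.exp_add]
          congr 1
          push_cast
          ring
        rw [h3]
        calc _ ≤ a * M i * (Real.exp 1 * Real.exp (i - (τ - Real.exp 1 * a * v))) := by gcongr
          _ = _ := by ring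
  intro i hi
  by_cases hik : i ≤ k
  · have := key (k - i) i hi (by omega) (x - y) ⟨by linarith, by linarith⟩
    rwa [sub_sub_cancel, mul_assoc] at this
  · have hki : (k : ℝ) ≤ i := by exact_mod_cast (not_le.1 hik).le
    refine le_mul_exp_sub (hM i) (hFM i _ ⟨hy, by linarith⟩) ?_
    have : 0 ≤ Real.exp 1 * (a * (x - y)) :=
      mul_nonneg (by positivity) (mul_nonneg ha (by linarith))
    linarith

/-! ### The primitive of 1/A and propagation along a chain -/

namespace DenjoyCarleman

/-- The primitive of `1 / A` vanishing at `1`. -/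
noncomputable def invPrimitive (A : ℝ → ℝ) (u : ℝ) : ℝ := ∫ s in (1 : ℝ)..u, (A s)⁻¹

variable {A : ℝ → ℝ}

theorem IsRegularQuasianalytic.continuousOn_inv (hA : IsRegularQuasianalytic A) :
    ContinuousOn (fun s => (A s)⁻¹) (Ici 1) :=
  hA.contDiffOn.continuousOn.inv₀ fun s hs => (hA.pos s hs).ne'

theorem IsRegularQuasianalytic.intervalIntegrable (hA : IsRegularQuasianalytic A) {u v : ℝ}
    (hu : 1 ≤ u) (hv : 1 ≤ v) :
    IntervalIntegrable (fun s => (A s)⁻¹) MeasureTheory.volume u v :=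
  (hA.continuousOn_inv.mono fun _ ht => (le_min hu hv).trans ht.1).intervalIntegrable

theorem IsRegularQuasianalytic.invPrimitive_sub (hA : IsRegularQuasianalytic A) {u v : ℝ}
    (hu : 1 ≤ u) (hv : 1 ≤ v) :
    invPrimitive A v - invPrimitive A u = ∫ s in u..v, (A s)⁻¹ :=
  intervalIntegral.integral_interval_sub_left (hA.intervalIntegrable le_rfl hv)
    (hA.intervalIntegrable le_rfl hu)

theorem IsRegularQuasianalytic.invPrimitive_le (hA : IsRegularQuasianalytic A) {u v : ℝ}
    (hu : 1 ≤ u) (huv : u ≤ v) : invPrimitive A u ≤ invPrimitive A v := by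
  rw [← sub_nonneg, hA.invPrimitive_sub hu (hu.trans huv)]
  exact intervalIntegral.integral_nonneg huv fun t ht => (inv_pos.2 (hA.pos t (hu.trans ht.1))).le

theorem IsRegularQuasianalytic.invPrimitive_sub_le (hA : IsRegularQuasianalytic A) {u v : ℝ}
    (hu : 1 ≤ u) (huv : u ≤ v) : invPrimitive A v - invPrimitive A u ≤ (v - u) * (A u)⁻¹ := by
  rw [hA.invPrimitive_sub hu (hu.trans huv)]
  calc ∫ s in u..v, (A s)⁻¹ ≤ ∫ _ in u..v, (A u)⁻¹ := by
        refine intervalIntegral.integral_mono_on huv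
          (hA.intervalIntegrable hu (hu.trans huv)) (by simp) fun t ht => ?_
        exact inv_anti₀ (hA.pos u hu) (hA.monotoneOn hu (hu.trans ht.1) ht.1)
    _ = _ := by simp

theorem IsRegularQuasianalytic.continuousOn_invPrimitive (hA : IsRegularQuasianalytic A) :
    ContinuousOn (fun τ => invPrimitive A (1 + τ)) (Ici 0) := by
  intro τ hτ
  rw [mem_Ici] at hτ
  have h1 : ContinuousOn (invPrimitive A) (uIcc 1 (τ + 2)) :=
    intervalIntegral.continuousOn_primitive_interval
      ((hA.continuousOn_inv.mono fun t ht => by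
        rw [uIcc_of_le (by linarith)] at ht
        exact ht.1).integrableOn_compact isCompact_uIcc)
  rw [uIcc_of_le (by linarith)] at h1
  have h2 : ContinuousOn (fun τ => invPrimitive A (1 + τ)) (Icc 0 (τ + 1)) :=
    h1.comp (by fun_prop) fun t ht => ⟨by linarith [ht.1], by linarith [ht.2]⟩
  refine (h2 τ ⟨hτ, by linarith⟩).mono_of_mem_nhdsWithin ?_
  exact Filter.mem_of_superset (inter_mem_nhdsWithin _ (Iio_mem_nhds (lt_add_one τ)))
    fun t ht => ⟨ht.1, ht.2.le⟩

theorem IsRegularQuasianalytic.exists_invPrimitive_eq (hA : IsRegularQuasianalytic A)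
    {τ T d : ℝ} (hτ : 0 ≤ τ) (hτT : τ ≤ T) (hd : 0 ≤ d)
    (hdT : d ≤ invPrimitive A (1 + T) - invPrimitive A (1 + τ)) :
    ∃ τ' ∈ Icc τ T, invPrimitive A (1 + T) - invPrimitive A (1 + τ') = d := by
  have hcont : ContinuousOn (fun τ => invPrimitive A (1 + τ)) (Icc τ T) :=
    hA.continuousOn_invPrimitive.mono fun t ht => hτ.trans ht.1
  obtain ⟨τ', hτ', h⟩ := intermediate_value_Icc hτT hcont
    (show invPrimitive A (1 + T) - d ∈ _ from ⟨by linarith, by linarith⟩)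
  exact ⟨τ', hτ', by simp only at h; linarith⟩

theorem IsRegularQuasianalytic.M_pos (hA : IsRegularQuasianalytic A) (j : ℕ) : 0 < M A j := by
  induction j with
  | zero => exact one_pos
  | succ j ih =>
    exact mul_pos ih (hA.pos _ (by linarith [(Nat.cast_nonneg j : (0 : ℝ) ≤ j)]))

theorem IsRegularQuasianalytic.M_succ_le (hA : IsRegularQuasianalytic A) {i k : ℕ} (hik : i < k) :
    M A (i + 1) ≤ A k * M A i := by
  have h1 : (1 : ℝ) ≤ (i : ℝ) + 1 := by linarith [(Nat.cast_nonneg i : (0 : ℝ) ≤ i)]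
  have h2 : (i : ℝ) + 1 ≤ k := by exact_mod_cast hik
  rw [mul_comm]
  exact mul_le_mul_of_nonneg_left (hA.monotoneOn h1 (h1.trans h2) h2) (hA.M_pos i).le

/-- Bang's propagation estimate. -/
theorem IsRegularQuasianalytic.smallFrom_of_le (hA : IsRegularQuasianalytic A)
    {F : ℕ → ℝ → ℝ} {j : ℕ}
    (hF : ∀ j, ∀ t ∈ Icc (0 : ℝ) 1, HasDerivWithinAt (F j) (F (j + 1) t) (Icc 0 1) t)
    (hFM : ∀ j, ∀ t ∈ Icc (0 : ℝ) 1, |F j t| ≤ M A j) {τ' y : ℝ} (hτ' : 0 ≤ τ') (hy : 0 ≤ y) :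
    ∀ (k : ℕ) (x τ : ℝ), τ ≤ k → τ' ≤ τ → x ≤ 1 → y ≤ x →
      Real.exp 1 * (x - y) ≤ invPrimitive A (1 + τ) - invPrimitive A (1 + τ') →
      SmallFrom (M A) F j x τ → SmallFrom (M A) F j y τ' := by
  have hM := fun i => (hA.M_pos i).le
  intro k
  induction k with
  | zero =>
    intro x τ hτ hττ hx hyx _ _ i _
    refine le_mul_exp_sub (hM i) (hFM i y ⟨hy, hyx.trans hx⟩) ?_
    have : (0 : ℝ) ≤ i := Nat.cast_nonneg i
    push_cast at hτ
    linarith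
  | succ k ih =>
    intro x τ hτ hττ hx hyx hd hS
    rcases le_or_gt τ k with hτk | hτk
    · exact ih x τ hτk hττ hx hyx hd hS
    have hk0 : (0 : ℝ) ≤ k := Nat.cast_nonneg k
    have hcast : ((k + 1 : ℕ) : ℝ) = 1 + k := by push_cast; ring
    have hApos : 0 < A ((k + 1 : ℕ) : ℝ) := hA.pos _ (by rw [hcast]; linarith)
    -- While τ stays in [k, k + 1] the ratios are bounded by A(k + 1), and 1 + σ ≥ k + 1 gives A(1 +
    -- σ) ≥ A(k + 1). This is why the primitive is taken at 1 + τ.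
    have step : ∀ σ z, (k : ℝ) ≤ σ → σ ≤ τ → 0 ≤ z → z ≤ x →
        Real.exp 1 * (x - z) ≤ invPrimitive A (1 + τ) - invPrimitive A (1 + σ) →
        SmallFrom (M A) F j z σ := by
      intro σ z hσk hστ hz hzx hdz
      refine (hS.move_left hF hFM hApos.le hM (fun i hi => hA.M_succ_le hi) hτ hx hz hzx).mono hM ?_
      have h1 := hA.invPrimitive_sub_le (u := 1 + σ) (v := 1 + τ) (by linarith) (by linarith)
      have h2 : (A (1 + σ))⁻¹ ≤ (A ((k + 1 : ℕ) : ℝ))⁻¹ := by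
        refine inv_anti₀ hApos (hA.monotoneOn ?_ ?_ ?_)
        · rw [mem_Ici, hcast]; linarith
        · rw [mem_Ici]; linarith
        · rw [hcast]; linarith
      have h3 : Real.exp 1 * (x - z) ≤ (τ - σ) * (A ((k + 1 : ℕ) : ℝ))⁻¹ := by
        refine hdz.trans (h1.trans ?_)
        rw [add_sub_add_left_eq_sub]
        exact mul_le_mul_of_nonneg_left h2 (by linarith)
      rw [← div_eq_mul_inv, le_div_iff₀ hApos] at h3
      nlinarith
    rcases le_or_gt (k : ℝ) τ' with hkτ | hkτ
    · exact step τ' y hkτ hττ hy hyx hd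
    · rcases le_or_gt (Real.exp 1 * (x - y))
        (invPrimitive A (1 + τ) - invPrimitive A (1 + k)) with hc | hc
      · exact (step k y le_rfl hτk.le hy hyx hc).mono hM hkτ.le
      -- The move is too long for one unit of τ: spend D/e of the distance to bring τ down to k,
      -- then apply induction.
      · set D := invPrimitive A (1 + τ) - invPrimitive A (1 + k) with hD
        have hD0 : 0 ≤ D := sub_nonneg.2 (hA.invPrimitive_le (by linarith) (by linarith))
        have he : 0 < Real.exp 1 := Real.exp_pos 1
        have hq : Real.exp 1 * (D / Real.exp 1) = D := by field_simp
        have hq0 : 0 ≤ D / Real.exp 1 := by positivity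
        have hqy : y ≤ x - D / Real.exp 1 := by
          have : D / Real.exp 1 ≤ x - y := by
            rw [div_le_iff₀ he]
            linarith
          linarith
        refine ih (x - D / Real.exp 1) k le_rfl hkτ.le (by linarith) hqy ?_
          (step k _ le_rfl hτk.le (hy.trans hqy) (by linarith) ?_)
        · rw [sub_right_comm, mul_sub, hq]
          linarith
        · rw [sub_sub_cancel, hq]

/-- The loss is charged against the distance from the end-point 1, so the costs of successive moves
telescope. -/
theorem IsRegularQuasianalytic.smallFrom_chain (hA : IsRegularQuasianalytic A)
    {F : ℕ → ℝ → ℝ} {n : ℕ} {ξ : ℕ → ℝ} {a T τ : ℝ}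
    (hF : ∀ j, ∀ t ∈ Icc (0 : ℝ) 1, HasDerivWithinAt (F j) (F (j + 1) t) (Icc 0 1) t)
    (hFM : ∀ j, ∀ t ∈ Icc (0 : ℝ) 1, |F j t| ≤ M A j) (hTn : T ≤ n + 1)
    (ha : 0 ≤ a) (haξ : a ≤ ξ 0) (hξmono : ∀ j < n, ξ j ≤ ξ (j + 1))
    (hξ01 : ∀ j < n + 1, ξ j ∈ Icc (0 : ℝ) 1)
    (hξ : ∀ j < n + 1, |F j (ξ j)| ≤ M A j * Real.exp (j - T))
    (hτ : 0 ≤ τ) (hτT : τ ≤ T)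
    (hd : Real.exp 1 * (1 - a) ≤ invPrimitive A (1 + T) - invPrimitive A (1 + τ)) :
    SmallFrom (M A) F 0 a τ := by
  have hM := fun i => (hA.M_pos i).le
  have he : 0 < Real.exp 1 := Real.exp_pos 1
  have move : ∀ j x y, x ∈ Icc (0 : ℝ) 1 → 0 ≤ y → y ≤ x →
      (∀ σ, 0 ≤ σ → σ ≤ T →
        Real.exp 1 * (1 - x) ≤ invPrimitive A (1 + T) - invPrimitive A (1 + σ) →
        SmallFrom (M A) F j x σ) →
      ∀ σ, 0 ≤ σ → σ ≤ T →
        Real.exp 1 * (1 - y) ≤ invPrimitive A (1 + T) - invPrimitive A (1 + σ) →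
        SmallFrom (M A) F j y σ := by
    intro j x y hx hy hyx h σ hσ hσT hdσ
    obtain ⟨σ', hσ', hσ'd⟩ := hA.exists_invPrimitive_eq hσ hσT
      (d := Real.exp 1 * (1 - x)) (mul_nonneg he.le (by linarith [hx.2]))
      (le_trans (by gcongr) hdσ)
    refine hA.smallFrom_of_le hF hFM hσ hy ⌈σ'⌉₊ x σ' (Nat.le_ceil _) hσ'.1 hx.2 hyx ?_
      (h σ' (hσ.trans hσ'.1) hσ'.2 hσ'd.ge)
    have : Real.exp 1 * (x - y) = Real.exp 1 * (1 - y) - Real.exp 1 * (1 - x) := by ring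
    linarith
  have add : ∀ j < n + 1, ∀ σ, σ ≤ T → SmallFrom (M A) F (j + 1) (ξ j) σ →
      SmallFrom (M A) F j (ξ j) σ := by
    intro j hj σ hσT h i hi
    rcases hi.eq_or_lt with rfl | hi
    · exact (hξ _ hj).trans
        (mul_le_mul_of_nonneg_left (Real.exp_le_exp.2 (by linarith)) (hM _))
    · exact h i hi
  have chain : ∀ d j, j + d = n → ∀ σ, 0 ≤ σ → σ ≤ T →
      Real.exp 1 * (1 - ξ j) ≤ invPrimitive A (1 + T) - invPrimitive A (1 + σ) →
      SmallFrom (M A) F j (ξ j) σ := by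
    intro d
    induction d with
    | zero =>
      rintro j rfl σ _ hσT _
      -- Orders i ≥ n + 1 ≥ T satisfy the weighted bound because the weight is at least 1.
      refine add j (by simp) σ hσT fun i hi => ?_
      refine le_mul_exp_sub (hM i) (hFM i _ (hξ01 _ (by simp))) ?_
      have : ((j + 1 : ℕ) : ℝ) ≤ i := by exact_mod_cast hi
      push_cast at this hTn
      linarith
    | succ d ih =>
      intro j hj σ hσ hσT hdσ
      exact add j (by omega) σ hσT (move (j + 1) _ _ (hξ01 (j + 1) (by omega))
        (hξ01 j (by omega)).1 (hξmono j (by omega)) (ih (j + 1) (by omega)) σ hσ hσT hdσ)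
  exact move 0 (ξ 0) a (hξ01 0 (by omega)) ha haξ (chain n 0 (by omega)) τ hτ hτT hd

/-! ### Propagation of smallness from a set to a point -/

/-- The factor 3 and the constant 4 + log 4 absorb (8/δ)^T and (n+1)^m/m! ≤ e^{T+1}, and still leave
e^{-2T}/2: one e^{-T} gives the weight, the other is compared with e^{-L}. -/
theorem exp_mul_pow_div_factorial_le {δ T : ℝ} {n m : ℕ} (hδ : 0 < δ) (hδ1 : δ ≤ 1)
    (hT : 1 ≤ T) (hn : n ≤ T) (hmn : m ≤ n) :
    Real.exp (-(3 * T * (4 + Real.log 4 - Real.log δ))) * (4 / (δ / (2 * (n + 1)))) ^ m /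
      m.factorial ≤ Real.exp (-2 * T) / 2 := by
  have h1 : ((n : ℝ) + 1) ^ m / m.factorial ≤ Real.exp (n + 1) :=
    Real.pow_div_factorial_le_exp _ (by positivity) m
  have h8 : (8 : ℝ) / δ = Real.exp (Real.log 8 - Real.log δ) := by
    rw [← Real.log_div (by norm_num) hδ.ne', Real.exp_log (by positivity)]
  have hlogδ : Real.log δ ≤ 0 := Real.log_nonpos hδ.le hδ1
  have hlog2 : 0 < Real.log 2 := Real.log_pos (by norm_num)
  have hl8 : Real.log 8 = 3 * Real.log 2 := by
    rw [show (8 : ℝ) = 2 ^ 3 by norm_num, Real.log_pow]; norm_num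
  have hl4 : Real.log 4 = 2 * Real.log 2 := by
    rw [show (4 : ℝ) = 2 ^ 2 by norm_num, Real.log_pow]; norm_num
  have h2 : ((8 : ℝ) / δ) ^ m ≤ Real.exp (T * (Real.log 8 - Real.log δ)) := by
    rw [h8, ← Real.exp_nat_mul]
    refine Real.exp_le_exp.2 (mul_le_mul_of_nonneg_right ?_ (by rw [hl8]; linarith))
    have : (m : ℝ) ≤ n := by exact_mod_cast hmn
    linarith
  have h3 : (4 / (δ / (2 * ((n : ℝ) + 1)))) ^ m = (8 / δ) ^ m * ((n : ℝ) + 1) ^ m := by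
    rw [← mul_pow]
    congr 1
    field_simp
    norm_num
  calc _ = Real.exp (-(3 * T * (4 + Real.log 4 - Real.log δ))) *
        (((8 : ℝ) / δ) ^ m * (((n : ℝ) + 1) ^ m / m.factorial)) := by rw [h3]; ring
    _ ≤ Real.exp (-(3 * T * (4 + Real.log 4 - Real.log δ))) *
        (Real.exp (T * (Real.log 8 - Real.log δ)) * Real.exp (T + 1)) := by
        gcongr
        exact h1.trans (Real.exp_le_exp.2 (by linarith))
    _ ≤ Real.exp (-2 * T - Real.log 2) := by
        rw [← Real.exp_add, ← Real.exp_add, Real.exp_le_exp, hl8, hl4]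
        nlinarith [mul_le_mul_of_nonneg_right hT hlog2.le,
          mul_nonneg (by linarith : 0 ≤ T) (neg_nonneg.2 hlogδ)]
    _ = _ := by rw [Real.exp_sub, Real.exp_log (by norm_num)]

/-- Propagation of smallness from a set to the right of a point. -/
theorem IsRegularQuasianalytic.invPrimitive_le_of_small_right (hA : IsRegularQuasianalytic A)
    {F : ℕ → ℝ → ℝ} {a δ L T : ℝ} {K : Set ℝ}
    (hF : ∀ j, ∀ t ∈ Icc (0 : ℝ) 1, HasDerivWithinAt (F j) (F (j + 1) t) (Icc 0 1) t)
    (hFM : ∀ j, ∀ t ∈ Icc (0 : ℝ) 1, |F j t| ≤ M A j) (ha : a ∈ Icc (0 : ℝ) 1)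
    (hK : IsCompact K) (hKa : K ⊆ Icc a 1) (hδ : 0 < δ) (hδ1 : δ ≤ 1)
    (hKδ : ENNReal.ofReal (δ / 2) ≤ MeasureTheory.volume K) (hL : 0 ≤ L) (hT : 0 ≤ T)
    (hFa : |F 0 a| = Real.exp (-L))
    (hFK : ∀ x ∈ K, |F 0 x| ≤ Real.exp (-(3 * T * (4 + Real.log 4 - Real.log δ)))) :
    invPrimitive A (1 + T) ≤ invPrimitive A (1 + L) + Real.exp 1 := by
  by_contra! hcon
  have he : 0 < Real.exp 1 := Real.exp_pos 1
  have hLT : L < T := by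
    by_contra! hTL
    linarith [hA.invPrimitive_le (u := 1 + T) (v := 1 + L) (by linarith) (by linarith)]
  have hT0 : 0 < T := hL.trans_lt hLT
  -- Thus n < T ≤ n + 1: n is small enough for the factorial estimate, and every order above n is
  -- trivially bounded.
  obtain ⟨n, hn⟩ : ∃ n, ⌈T⌉₊ = n + 1 := Nat.exists_eq_succ_of_ne_zero (Nat.ceil_pos.2 hT0).ne'
  have hnT : (n : ℝ) < T := Nat.lt_ceil.1 (by omega)
  have hTn : T ≤ n + 1 := by
    have := Nat.le_ceil T
    rw [hn] at this
    exact_mod_cast this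
  set s := Real.exp (-(3 * T * (4 + Real.log 4 - Real.log δ))) with hs
  have hs0 : 0 ≤ s := (Real.exp_pos _).le
  set h := δ / (2 * ((n : ℝ) + 1)) with hh
  have hh0 : 0 < h := by positivity
  have hlogδ : Real.log δ ≤ 0 := Real.log_nonpos hδ.le hδ1
  have hlog4 : 0 < Real.log 4 := Real.log_pos (by norm_num)
  have hsT : s ≤ Real.exp (-T) := by
    refine Real.exp_le_exp.2 ?_
    nlinarith
  have hT1 : 1 ≤ n → 1 ≤ T := fun h1 => by
    have : (1 : ℝ) ≤ n := by exact_mod_cast h1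
    linarith
  have hnum : 1 ≤ n → ∀ m ≤ n, s * (4 / h) ^ m / m.factorial ≤ Real.exp (-2 * T) / 2 :=
    fun h1 m hm => exp_mul_pow_div_factorial_le hδ hδ1 (hT1 h1) hnT.le hm
  have h2T : Real.exp (-2 * T) = Real.exp (-T) * Real.exp (-T) := by
    rw [← Real.exp_add]; ring_nf
  have hST : Real.exp (-T) < Real.exp (-L) := Real.exp_lt_exp.2 (by linarith)
  obtain ⟨x, hxK, hxh⟩ := exists_separated_nodes hh0.le n K hK (by
    refine lt_of_lt_of_le ((ENNReal.ofReal_lt_ofReal_iff (by positivity)).2 ?_) hKδ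
    rw [hh, ← mul_div_assoc, div_lt_div_iff₀ (by positivity) (by positivity)]
    nlinarith)
  have hsep := sub_mul_le_sub_of_separated hxh
  have hx01 : ∀ i < n + 1, x i ∈ Icc (0 : ℝ) 1 := fun i hi =>
    ⟨ha.1.trans (hKa (hxK i hi)).1, (hKa (hxK i hi)).2⟩
  have hlt : ∀ i j, i < j → j < n + 1 → x i < x j := by
    intro i j hij hj
    have h1 := hsep i j hij.le hj
    have h2 : (i : ℝ) < j := by exact_mod_cast hij
    nlinarith [mul_pos (sub_pos.2 h2) hh0]
  -- Otherwise interpolation at j nodes would have error below e^{-L}/2 at a, while the interpolant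
  -- there is at most e^{-2T}/2, contradicting |f(a)| = e^{-L}.
  have hfac : ∀ j, 1 ≤ j → j ≤ n → Real.exp (-L) / 2 * j.factorial ≤ M A j := by
    intro j hj hjn
    by_contra! hlow
    obtain ⟨p, rfl⟩ : ∃ p, j = p + 1 := ⟨j - 1, by omega⟩
    have h1 := abs_sub_interpolate_le (n := p + 1) (x := x) (a := a) hF (hFM (p + 1))
      (fun i hi => hx01 i (by omega)) ha (fun i j hij hj => hlt i j hij (by omega))
      (fun i hi => (hKa (hxK i (by omega))).1)
    have h2 := abs_eval_iterate_derivative_interpolate_le (n := p) (x := x)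
      (r := fun i => F 0 (x i)) (k := 0) hh0 hs0 (fun i j hij hj => hsep i j hij (by omega))
      (fun i hi => hx01 i (by omega)) (fun i hi => hFK _ (hxK i (by omega))) (by omega) ha
    rw [Function.iterate_zero_apply, Nat.factorial_zero, Nat.cast_one, mul_one] at h2
    have h3 := h2.trans (hnum (by omega) p (by omega))
    have h4 : M A (p + 1) / (p + 1).factorial < Real.exp (-L) / 2 := by
      rwa [div_lt_iff₀ (by positivity)]
    have h5 := abs_sub_abs_le_abs_sub (F 0 a)
      ((Lagrange.interpolate (Finset.range (p + 1)) x (fun i => F 0 (x i))).eval a)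
    have h6 : Real.exp (-T) ≤ 1 := Real.exp_le_one_iff.2 (by linarith)
    rw [hFa] at h5
    nlinarith [Real.exp_pos (-T)]
  have hinj : Set.InjOn x (Finset.range (n + 1) : Finset ℕ) := by
    intro i hi j hj hij
    simp only [Finset.coe_range, mem_Iio] at hi hj
    rcases lt_trichotomy i j with h1 | h1 | h1
    · exact absurd hij (hlt i j h1 hj).ne
    · exact h1
    · exact absurd hij (hlt j i h1 hi).ne'
  set P := Lagrange.interpolate (Finset.range (n + 1)) x (fun i => F 0 (x i)) with hP
  obtain ⟨ξ, hξ0, hξmono, hξ⟩ := exists_zero_chain n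
    (fun j t => F j t - (derivative^[j] P).eval t) x
    (fun j t ht => (hF j t ht).sub (hasDerivWithinAt_iterate_derivative P j _ t))
    hx01 (fun i hi => hlt i (i + 1) (by omega) (by omega)) (fun i hi => by
      change F 0 (x i) - P.eval (x i) = 0
      rw [hP, Lagrange.eval_interpolate_at_node _ hinj (Finset.mem_range.2 hi), sub_self])
  have hsmall : ∀ j < n + 1, |F j (ξ j)| ≤ M A j * Real.exp (j - T) := by
    intro j hj
    rcases Nat.eq_zero_or_pos j with rfl | hj0
    · rw [hξ0]
      refine (hFK _ (hxK 0 hj)).trans (hsT.trans (le_of_eq ?_))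
      simp [M]
    · have hz := (hξ j hj).2
      rw [sub_eq_zero] at hz
      rw [hz]
      refine (abs_eval_iterate_derivative_interpolate_le hh0 hs0 hsep hx01
        (fun i hi => hFK _ (hxK i hi)) hj (hξ j hj).1).trans ?_
      have h1 := hnum (by omega) n le_rfl
      have h2 := hfac j hj0 (by omega)
      have h3 : Real.exp (-T) ≤ Real.exp (j - T) :=
        Real.exp_le_exp.2 (by linarith [(Nat.cast_nonneg j : (0 : ℝ) ≤ j)])
      have hE := Real.exp_pos (-T)
      calc _ = (j.factorial : ℝ) * (s * (4 / h) ^ n / n.factorial) := by ring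
        _ ≤ j.factorial * (Real.exp (-T) * Real.exp (-T) / 2) := by
            rw [← h2T]; gcongr
        _ = (Real.exp (-T) / 2 * j.factorial) * Real.exp (-T) := by ring
        _ ≤ (Real.exp (-L) / 2 * j.factorial) * Real.exp (-T) := by gcongr
        _ ≤ M A j * Real.exp (j - T) := mul_le_mul h2 h3 hE.le (hA.M_pos j).le
  -- Choose τ to spend exactly the budget e, enough to travel distance 1; the assumed strict
  -- inequality makes τ > L.
  obtain ⟨τ, hτ, hτd⟩ := hA.exists_invPrimitive_eq hL hLT.le he.le (by linarith)
  have hτL : L < τ := lt_of_le_of_ne hτ.1 (by rintro rfl; linarith)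
  have hfin := hA.smallFrom_chain hF hFM hTn ha.1 (hξ0 ▸ (hKa (hxK 0 (by omega))).1) hξmono
    (fun j hj => (hξ j hj).1) hsmall (hL.trans hτ.1) hτ.2
    (by rw [hτd]; exact mul_le_of_le_one_right he.le (by linarith [ha.1])) 0 le_rfl
  rw [hFa] at hfin
  simp only [M, one_mul, Nat.cast_zero, zero_sub, Real.exp_le_exp] at hfin
  linarith

/-- One side of a carries at least half the measure; the left side is reduced to the right by t ↦ 1
- t, with signs (-1)^j on the derivatives. -/
theorem IsRegularQuasianalytic.invPrimitive_le_of_small (hA : IsRegularQuasianalytic A)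
    {F : ℕ → ℝ → ℝ} {a δ L T : ℝ} {K : Set ℝ}
    (hF : ∀ j, ∀ t ∈ Icc (0 : ℝ) 1, HasDerivWithinAt (F j) (F (j + 1) t) (Icc 0 1) t)
    (hFM : ∀ j, ∀ t ∈ Icc (0 : ℝ) 1, |F j t| ≤ M A j) (ha : a ∈ Icc (0 : ℝ) 1)
    (hK : IsCompact K) (hK01 : K ⊆ Icc 0 1) (hδ : 0 < δ) (hδ1 : δ ≤ 1)
    (hKδ : ENNReal.ofReal δ ≤ MeasureTheory.volume K) (hL : 0 ≤ L) (hT : 0 ≤ T)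
    (hFa : |F 0 a| = Real.exp (-L))
    (hFK : ∀ x ∈ K, |F 0 x| ≤ Real.exp (-(3 * T * (4 + Real.log 4 - Real.log δ)))) :
    invPrimitive A (1 + T) ≤ invPrimitive A (1 + L) + Real.exp 1 := by
  have hor : ENNReal.ofReal (δ / 2) ≤ MeasureTheory.volume (K ∩ Ici a) ∨
      ENNReal.ofReal (δ / 2) ≤ MeasureTheory.volume (K ∩ Iic a) := by
    by_contra! hcon
    refine absurd hKδ (not_le.2 ?_)
    calc MeasureTheory.volume K
        ≤ MeasureTheory.volume ((K ∩ Ici a) ∪ (K ∩ Iic a)) :=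
          MeasureTheory.measure_mono fun t ht => (le_total a t).imp (⟨ht, ·⟩) (⟨ht, ·⟩)
      _ ≤ _ := MeasureTheory.measure_union_le _ _
      _ < ENNReal.ofReal (δ / 2) + ENNReal.ofReal (δ / 2) := ENNReal.add_lt_add hcon.1 hcon.2
      _ = ENNReal.ofReal δ := by
          rw [← ENNReal.ofReal_add (by positivity) (by positivity), add_halves]
  rcases hor with hv | hv
  · exact hA.invPrimitive_le_of_small_right hF hFM ha (hK.inter_right isClosed_Ici)
      (fun t ht => ⟨ht.2, (hK01 ht.1).2⟩) hδ hδ1 hv hL hT hFa (fun x hx => hFK x hx.1)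
  · have hmaps : ∀ t ∈ Icc (0 : ℝ) 1, 1 - t ∈ Icc (0 : ℝ) 1 := fun t ht =>
      ⟨by linarith [ht.2], by linarith [ht.1]⟩
    have hinv : (fun t : ℝ => 1 - t) '' (K ∩ Iic a) = (fun t : ℝ => 1 - t) ⁻¹' (K ∩ Iic a) :=
      congrFun (image_eq_preimage_of_inverse (fun t : ℝ => sub_sub_cancel 1 t)
        fun t : ℝ => sub_sub_cancel 1 t) _
    refine hA.invPrimitive_le_of_small_right (F := fun j t => (-1) ^ j * F j (1 - t))
      (a := 1 - a) (K := (fun t : ℝ => 1 - t) '' (K ∩ Iic a)) (δ := δ) ?_ ?_ (hmaps a ha)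
      ((hK.inter_right isClosed_Iic).image (by fun_prop)) ?_ hδ hδ1 ?_ hL hT ?_ ?_
    · intro j t ht
      have h1 : HasDerivWithinAt (fun t : ℝ => 1 - t) (-1) (Icc 0 1) t :=
        ((hasDerivAt_id t).const_sub 1).hasDerivWithinAt
      have h2 := ((hF j (1 - t) (hmaps t ht)).comp t h1 hmaps).const_mul ((-1 : ℝ) ^ j)
      refine h2.congr_deriv ?_
      rw [pow_succ]
      ring
    · intro j t ht
      simpa [abs_mul] using hFM j _ (hmaps t ht)
    · rintro _ ⟨t, ht, rfl⟩
      exact ⟨sub_le_sub_left ht.2 1, by linarith [(hK01 ht.1).1]⟩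
    · rw [hinv, (MeasureTheory.Measure.measurePreserving_sub_left
        MeasureTheory.volume (1 : ℝ)).measure_preimage
        (hK.inter_right isClosed_Iic).measurableSet.nullMeasurableSet]
      exact hv
    · simpa using hFa
    · rintro _ ⟨t, ht, rfl⟩
      simpa using hFK t ht.1

/-! ### Translation into the inequality for Ω -/

theorem IsRegularQuasianalytic.growthExponent_nonneg (hA : IsRegularQuasianalytic A) :
    0 ≤ growthExponent A := by
  refine Real.sSup_nonneg ?_
  rintro _ ⟨s, hs, rfl⟩
  have hs1 : (1 : ℝ) ≤ s := hs
  exact div_nonneg (mul_nonneg (by linarith) hA.monotoneOn.derivWithin_nonneg) (hA.pos s hs).le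

theorem Omega_of_pos {t : ℝ} (ht : 0 < t) :
    Omega A t = Real.exp (-(1 / Real.exp 1) * invPrimitive A (1 - Real.log t)) := by
  rw [Omega, if_neg ht.ne', invPrimitive, Real.log_div (Real.exp_pos 1).ne' ht.ne', Real.log_exp]

theorem Omega_nonneg (t : ℝ) : 0 ≤ Omega A t := by
  rw [Omega]
  split_ifs
  · exact le_rfl
  · exact (Real.exp_pos _).le

end DenjoyCarleman

open DenjoyCarleman

theorem corollary5p5p1 (A : ℝ → ℝ) (hA : DenjoyCarleman.IsRegularQuasianalytic A)
    (f : ℝ → ℝ) (hf : f ∈ DenjoyCarleman.carlemanClass A)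
    (E : Set ℝ) (hE : MeasureTheory.NullMeasurableSet E MeasureTheory.volume)
    (hE01 : E ⊆ Set.Icc 0 1) (hEpos : 0 < MeasureTheory.volume E) :
    DenjoyCarleman.Omega A (DenjoyCarleman.supNorm f (Set.Icc 0 1)) ≤
      Real.exp 1 *
        DenjoyCarleman.Omega A (DenjoyCarleman.supNorm f E ^ DenjoyCarleman.alpha A E) := by
  obtain ⟨hfc, hfM⟩ := hf
  have hcont : ContinuousOn f (Icc 0 1) := hfc.continuousOn
  have hF : ∀ j, ∀ t ∈ Icc (0 : ℝ) 1, HasDerivWithinAt (iteratedDerivWithin j f (Icc 0 1))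
      (iteratedDerivWithin (j + 1) f (Icc 0 1) t) (Icc 0 1) t := by
    intro j t ht
    rw [iteratedDerivWithin_succ]
    exact (hfc.differentiableOn_iteratedDerivWithin
      (by exact_mod_cast ENat.natCast_lt_top j) (uniqueDiffOn_Icc zero_lt_one) t ht).hasDerivWithinAt
  have hf1 : ∀ x ∈ Icc (0 : ℝ) 1, |f x| ≤ 1 := fun x hx => by
    simpa [M] using hfM 0 x hx
  have hE0 : E.Nonempty := by
    rw [nonempty_iff_ne_empty]
    rintro rfl
    simp at hEpos
  obtain ⟨a, ha, hamax⟩ := isCompact_Icc.exists_isMaxOn (nonempty_Icc.2 zero_le_one) hcont.abs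
  have hSa : supNorm f (Icc 0 1) = |f a| :=
    IsGreatest.csSup_eq ⟨mem_image_of_mem _ ha, by rintro _ ⟨x, hx, rfl⟩; exact hamax hx⟩
  have hEs : ∀ x ∈ E, |f x| ≤ supNorm f E := fun x hx =>
    le_csSup ⟨1, by rintro _ ⟨y, hy, rfl⟩; exact hf1 y (hE01 hy)⟩ (mem_image_of_mem _ hx)
  have hs0 : 0 ≤ supNorm f E := by
    obtain ⟨x, hx⟩ := hE0
    exact (abs_nonneg _).trans (hEs x hx)
  have hs1 : supNorm f E ≤ 1 := by
    refine csSup_le (hE0.image _) ?_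
    rintro _ ⟨y, hy, rfl⟩
    exact hf1 y (hE01 hy)
  -- The closure supplies the required compact set: the bound on |f| extends by continuity and the
  -- measure does not decrease.
  have hK01 : closure E ⊆ Icc 0 1 := closure_minimal hE01 isClosed_Icc
  have hKs : ∀ x ∈ closure E, |f x| ≤ supNorm f E := fun x hx =>
    ContinuousWithinAt.closure_le (f := fun x => |f x|) (g := fun _ => supNorm f E) hx
      ((hcont.abs x (hK01 hx)).mono hE01) continuousWithinAt_const hEs
  have hvol : MeasureTheory.volume E ≤ 1 :=
    (MeasureTheory.measure_mono hE01).trans (by simp)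
  have hfin : MeasureTheory.volume E ≠ ⊤ := (hvol.trans_lt ENNReal.one_lt_top).ne
  set δ := (MeasureTheory.volume E).toReal with hδ
  have hδ0 : 0 < δ := ENNReal.toReal_pos hEpos.ne' hfin
  have hδ1 : δ ≤ 1 := by simpa using ENNReal.toReal_mono ENNReal.one_ne_top hvol
  have hlogδ : Real.log δ ≤ 0 := Real.log_nonpos hδ0.le hδ1
  have hlog4 : 0 < Real.log 4 := Real.log_pos (by norm_num)
  have hγ : 0 ≤ 2 / Real.exp 1 * growthExponent A :=
    mul_nonneg (by positivity) hA.growthExponent_nonneg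
  set Λ := Real.log (Gam A / δ) with hΛ
  -- Since γ ≥ 0, Γ is at least 4e^4.
  have hΛ0 : 4 + Real.log 4 - Real.log δ ≤ Λ := by
    rw [hΛ, Gam, Real.log_div (by positivity) hδ0.ne',
      Real.log_mul (by norm_num) (Real.exp_pos _).ne', Real.log_exp]
    linarith
  have hΛpos : 0 < Λ := by linarith
  have hα : alpha A E = (3 * Λ)⁻¹ := by
    rw [alpha, ← hδ, ← hΛ, mul_inv, one_div]
  rcases (abs_nonneg (f a)).eq_or_lt with h0 | hapos
  · rw [hSa, ← h0, Omega, if_pos rfl]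
    exact mul_nonneg (Real.exp_pos 1).le (Omega_nonneg _)
  set L := -Real.log |f a| with hL
  have hL0 : 0 ≤ L := neg_nonneg.2 (Real.log_nonpos hapos.le (hf1 a ha))
  have key : ∀ T, 0 ≤ T → supNorm f E ≤ Real.exp (-(3 * Λ * T)) →
      invPrimitive A (1 + T) ≤ invPrimitive A (1 + L) + Real.exp 1 := by
    intro T hT hsT
    refine hA.invPrimitive_le_of_small hF hfM ha (isCompact_Icc.of_isClosed_subset
      isClosed_closure hK01) hK01 hδ0 hδ1 ?_ hL0 hT ?_ fun x hx => ?_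
    · rw [hδ, ENNReal.ofReal_toReal hfin]
      exact MeasureTheory.measure_mono subset_closure
    · rw [iteratedDerivWithin_zero, hL, neg_neg, Real.exp_log hapos]
    · rw [iteratedDerivWithin_zero]
      refine (hKs x hx).trans (hsT.trans (Real.exp_le_exp.2 ?_))
      nlinarith [mul_le_mul_of_nonneg_left hΛ0 hT]
  rcases hs0.eq_or_lt with h0 | hspos
  -- If f vanishes on E, `key` holds for every T ≥ 0, so divergence of the integral contradicts f(a)
  -- ≠ 0.
  · obtain ⟨T, hT, hT1⟩ := ((hA.diverges.eventually_gt_atTop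
      (invPrimitive A (1 + L) + Real.exp 1)).and (Filter.eventually_ge_atTop 1)).exists
    have := key (T - 1) (by linarith) (by rw [← h0]; positivity)
    rw [add_sub_cancel] at this
    exact absurd hT (not_lt.2 this)
  -- This T equals -log of the power of the norm on E appearing in the conclusion.
  · have hT : 0 ≤ -Real.log (supNorm f E) / (3 * Λ) :=
      div_nonneg (neg_nonneg.2 (Real.log_nonpos hs0 hs1)) (by positivity)
    have h1 := key _ hT (by
      rw [mul_div_cancel₀ _ (by positivity), neg_neg, Real.exp_log hspos])
    rw [hSa, Omega_of_pos hapos, Omega_of_pos (Real.rpow_pos_of_pos hspos _),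
      Real.log_rpow hspos, hα, ← Real.exp_add, Real.exp_le_exp, sub_eq_add_neg 1 (Real.log |f a|),
      ← hL]
    have h2 : 1 - (3 * Λ)⁻¹ * Real.log (supNorm f E) =
        1 + -Real.log (supNorm f E) / (3 * Λ) := by ring
    rw [h2]
    have he : 0 < Real.exp 1 := Real.exp_pos 1
    have h3 := mul_le_mul_of_nonneg_left h1 (by positivity : 0 ≤ 1 / Real.exp 1)
    have h4 : 1 / Real.exp 1 * (invPrimitive A (1 + L) + Real.exp 1) =
        1 / Real.exp 1 * invPrimitive A (1 + L) + 1 := by field_simp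
    linarith
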